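/- Let $(M,d)$ be a connected bounded metric space with at least two points and a distinguished base point $0\in M$, and let $f:M\to M$ be a Lipschitz map with $f(0)=0$. Let $\mathrm{Lip}_0(M)$ be the Banach space of Lipschitz functions $g:M\to\mathbb C$ with $g(0)=0$, with norm $\|g\|_L=\sup_{x\ne y}\frac{|g(x)-g(y)|}{d(x,y)}$. For $x\in M$ let $\delta(x)\in \mathrm{Lip}_0(M)^*$ be the evaluation functional $g\mapsto g(x)$, and let $\mathcal F(M)\subset \mathrm{Lip}_0(M)^*$ be the norm-closed linear span of $\{\delta(x):x\in M\}$ (the Lipschitz-free space). Let $C_f:\mathrm{Lip}_0(M)\to\mathrm{Lip}_0(M)$ be the composition operator $C_f(g)=g\circ f$, and let $\widehat f:\mathcal F(M)\to\mathcal F(M)$ be the unique bounded linear operator with $\widehat f(\delta(x))=\delta(f(x))$ for all $x\in M$. If $\widehat f$ is compact, then $$\sigma(C_f)=\sigma(\widehat f)=\{0\},$$ where $\sigma(T)$ denotes the spectrum of $T$, i.e. the set of $\lambda\in\mathbb C$ such that $T-\lambda\,\mathrm{Id}$ is not invertible. -/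

import Mathlib

open scoped NNReal

noncomputable section

namespace LipFree

variable {M : Type*} [MetricSpace M]

/-- The complex-valued Lipschitz functions on `M` that vanish at the base point `o`,
as a linear subspace of `M → ℂ`. -/
def lipZeroSubmodule (o : M) : Submodule ℂ (M → ℂ) where
  carrier := {g | (∃ K : ℝ≥0, LipschitzWith K g) ∧ g o = 0}
  zero_mem' := ⟨⟨0, LipschitzWith.const 0⟩, rfl⟩
  add_mem' := by
    rintro g h ⟨⟨K, hg⟩, hg0⟩ ⟨⟨L, hh⟩, hh0⟩
    exact ⟨⟨K + L, hg.add hh⟩, by simp [hg0, hh0]⟩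
  smul_mem' := by
    rintro c g ⟨⟨K, hg⟩, hg0⟩
    exact ⟨⟨‖c‖₊ * K, (lipschitzWith_smul c).comp hg⟩, by simp [hg0]⟩

/-- The space `Lip₀(M)` of the pointed metric space `(M, o)`. (A separate type, so that it carries
the Lipschitz norm below and not the topology of pointwise convergence.) -/
def LipZero (o : M) : Type _ := ↥(lipZeroSubmodule o)

namespace LipZero

variable {o : M}

instance : AddCommGroup (LipZero o) := inferInstanceAs (AddCommGroup ↥(lipZeroSubmodule o))

instance : Module ℂ (LipZero o) := inferInstanceAs (Module ℂ ↥(lipZeroSubmodule o))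

instance : CoeFun (LipZero o) (fun _ => M → ℂ) := ⟨fun g => g.1⟩

theorem ext {g h : LipZero o} (H : ∀ x, g x = h x) : g = h := Subtype.ext (funext H)

@[simp] theorem zero_apply (x : M) : (0 : LipZero o) x = 0 := rfl

@[simp] theorem add_apply (g h : LipZero o) (x : M) : (g + h) x = g x + h x := rfl

@[simp] theorem smul_apply (c : ℂ) (g : LipZero o) (x : M) : (c • g) x = c * g x := rfl

theorem apply_base (g : LipZero o) : g o = 0 := g.2.2

/-- The Lipschitz norm: the supremum of `|g x - g y| / d(x, y)`. (The pairs with `x = y`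
contribute the value `0`.) -/
instance : Norm (LipZero o) := ⟨fun g => ⨆ p : M × M, ‖g p.1 - g p.2‖ / dist p.1 p.2⟩

theorem norm_def (g : LipZero o) :
    ‖g‖ = ⨆ p : M × M, ‖g p.1 - g p.2‖ / dist p.1 p.2 := rfl

theorem quot_le {g : LipZero o} {C : ℝ} (hC : 0 ≤ C)
    (h : ∀ x y, ‖g x - g y‖ ≤ C * dist x y) (p : M × M) :
    ‖g p.1 - g p.2‖ / dist p.1 p.2 ≤ C :=
  div_le_of_le_mul₀ dist_nonneg hC (h p.1 p.2)

theorem norm_le {g : LipZero o} {C : ℝ} (hC : 0 ≤ C)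
    (h : ∀ x y, ‖g x - g y‖ ≤ C * dist x y) : ‖g‖ ≤ C := by
  have : Nonempty M := ⟨o⟩
  exact ciSup_le (quot_le hC h)

theorem bddAbove (g : LipZero o) :
    BddAbove (Set.range fun p : M × M => ‖g p.1 - g p.2‖ / dist p.1 p.2) := by
  obtain ⟨K, hK⟩ := g.2.1
  refine ⟨K, ?_⟩
  rintro _ ⟨p, rfl⟩
  exact quot_le K.2 (fun x y => by simpa [dist_eq_norm] using hK.dist_le_mul x y) p

theorem norm_sub_le (g : LipZero o) (x y : M) : ‖g x - g y‖ ≤ ‖g‖ * dist x y := by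
  rcases eq_or_ne x y with rfl | hxy
  · simp
  · rw [← div_le_iff₀ (dist_pos.2 hxy)]
    exact le_ciSup (bddAbove g) (x, y)

theorem norm_nonneg' (g : LipZero o) : 0 ≤ ‖g‖ :=
  Real.iSup_nonneg fun _ => by positivity

theorem norm_smul_le' (c : ℂ) (g : LipZero o) : ‖c • g‖ ≤ ‖c‖ * ‖g‖ :=
  norm_le (mul_nonneg (norm_nonneg _) (norm_nonneg' g)) fun x y => by
    rw [smul_apply, smul_apply, ← mul_sub, norm_mul, mul_assoc]
    exact mul_le_mul_of_nonneg_left (norm_sub_le g x y) (norm_nonneg c)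

theorem core : NormedSpace.Core ℂ (LipZero o) where
  norm_nonneg := norm_nonneg'
  norm_smul c g := by
    refine le_antisymm (norm_smul_le' c g) ?_
    rcases eq_or_ne c 0 with rfl | hc
    · simpa using norm_nonneg' _
    · have h := norm_smul_le' c⁻¹ (c • g)
      rw [inv_smul_smul₀ hc, norm_inv] at h
      calc ‖c‖ * ‖g‖ ≤ ‖c‖ * (‖c‖⁻¹ * ‖c • g‖) :=
            mul_le_mul_of_nonneg_left h (norm_nonneg c)
        _ = ‖c • g‖ := by rw [mul_inv_cancel_left₀ (norm_ne_zero_iff.2 hc)]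
  norm_triangle g h :=
    norm_le (add_nonneg (norm_nonneg' g) (norm_nonneg' h)) fun x y => by
      rw [add_apply, add_apply, add_sub_add_comm, add_mul]
      exact (norm_add_le _ _).trans (add_le_add (norm_sub_le g x y) (norm_sub_le h x y))
  norm_eq_zero_iff g := by
    constructor
    · intro h
      refine ext fun x => ?_
      have := norm_sub_le g x o
      rw [h, zero_mul, apply_base, sub_zero] at this
      simpa using this
    · rintro rfl
      exact le_antisymm (norm_le le_rfl fun x y => by simp) (norm_nonneg' _)

instance : NormedAddCommGroup (LipZero o) := NormedAddCommGroup.ofCore core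

instance : NormedSpace ℂ (LipZero o) := NormedSpace.ofCore core

end LipZero

/-- The composition operator `C_f : g ↦ g ∘ f` on `Lip₀(M)`, for a base point preserving
Lipschitz map `f : M → M`. -/
def compOp (o : M) (f : M → M) {K : ℝ≥0} (hf : LipschitzWith K f) (h0 : f o = o) :
    LipZero o →L[ℂ] LipZero o :=
  LinearMap.mkContinuous
    { toFun := fun g => ⟨fun x => g (f x),
        ⟨g.2.1.imp' (fun L => L * K) fun _ hL => hL.comp hf, by
          show g (f o) = 0
          rw [h0, g.apply_base]⟩⟩
      map_add' := fun _ _ => rfl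
      map_smul' := fun _ _ => rfl }
    K fun g => LipZero.norm_le (mul_nonneg K.2 (norm_nonneg g)) fun x y =>
      (g.norm_sub_le (f x) (f y)).trans <| by
        rw [mul_comm (K : ℝ), mul_assoc]
        exact mul_le_mul_of_nonneg_left (hf.dist_le_mul x y) (norm_nonneg g)

@[simp] theorem compOp_apply (o : M) (f : M → M) {K : ℝ≥0} (hf : LipschitzWith K f)
    (h0 : f o = o) (g : LipZero o) (x : M) : compOp o f hf h0 g x = g (f x) := rfl

/-- The evaluation functional `δ(x) ∈ Lip₀(M)*`, `δ(x)(g) = g x`. -/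
def evalFunctional (o x : M) : StrongDual ℂ (LipZero o) :=
  LinearMap.mkContinuous
    { toFun := fun g => g x
      map_add' := fun _ _ => rfl
      map_smul' := fun _ _ => rfl }
    (dist x o) fun g => by
      have := g.norm_sub_le x o
      rw [g.apply_base, sub_zero, mul_comm] at this
      exact this

@[simp] theorem evalFunctional_apply (o x : M) (g : LipZero o) :
    evalFunctional o x g = g x := rfl

/-- The norm-closed linear span of the evaluation functionals in the dual Banach space
`Lip₀(M)*`. -/
def freeSubmodule (o : M) : Submodule ℂ (StrongDual ℂ (LipZero o)) :=
  (Submodule.span ℂ (Set.range (evalFunctional o))).topologicalClosure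

/-- The Lipschitz-free space `F(M)`: the closed subspace `freeSubmodule o` of `Lip₀(M)*`, with
the induced norm. -/
def FreeSpace (o : M) : Type _ := ↥(freeSubmodule o)

instance (o : M) : NormedAddCommGroup (FreeSpace o) :=
  inferInstanceAs (NormedAddCommGroup ↥(freeSubmodule o))

instance (o : M) : NormedSpace ℂ (FreeSpace o) :=
  inferInstanceAs (NormedSpace ℂ ↥(freeSubmodule o))

/-- The isometric inclusion of `F(M)` in `Lip₀(M)*`. -/
def FreeSpace.incl (o : M) : FreeSpace o →ₗᵢ[ℂ] StrongDual ℂ (LipZero o) where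
  toFun γ := γ.1
  map_add' _ _ := rfl
  map_smul' _ _ := rfl
  norm_map' _ := rfl

/-- The canonical map `δ : M → F(M)`. -/
def delta (o x : M) : FreeSpace o :=
  ⟨evalFunctional o x, Submodule.le_topologicalClosure _ (Submodule.subset_span ⟨x, rfl⟩)⟩

theorem incl_delta (o x : M) : FreeSpace.incl o (delta o x) = evalFunctional o x := rfl

/-- The adjoint `φ ↦ φ ∘ C_f` of the composition operator, on `Lip₀(M)*`. -/
def compOpDual (o : M) (f : M → M) {K : ℝ≥0} (hf : LipschitzWith K f) (h0 : f o = o) :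
    StrongDual ℂ (LipZero o) →L[ℂ] StrongDual ℂ (LipZero o) :=
  (ContinuousLinearMap.compL ℂ (LipZero o) (LipZero o) ℂ).flip (compOp o f hf h0)

theorem compOpDual_mem (o : M) (f : M → M) {K : ℝ≥0} (hf : LipschitzWith K f) (h0 : f o = o)
    (γ : FreeSpace o) : compOpDual o f hf h0 γ.1 ∈ freeSubmodule o := by
  have hmaps : Set.MapsTo (compOpDual o f hf h0)
      (Submodule.span ℂ (Set.range (evalFunctional o)))
      (Submodule.span ℂ (Set.range (evalFunctional o))) := by
    intro φ hφ
    have hle : Submodule.span ℂ (Set.range (evalFunctional o)) ≤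
        (Submodule.span ℂ (Set.range (evalFunctional o))).comap
          (compOpDual o f hf h0 : StrongDual ℂ (LipZero o) →ₗ[ℂ] StrongDual ℂ (LipZero o)) := by
      rw [Submodule.span_le]
      rintro _ ⟨x, rfl⟩
      exact Submodule.subset_span ⟨f x, rfl⟩
    exact hle hφ
  exact hmaps.closure (compOpDual o f hf h0).continuous γ.2

/-- The Lipschitz operator `f̂ : F(M) → F(M)`: the bounded linear operator with
`f̂ (δ x) = δ (f x)`. See `lipOp_delta` and `eq_lipOp` for this characterization. -/
def lipOp (o : M) (f : M → M) {K : ℝ≥0} (hf : LipschitzWith K f) (h0 : f o = o) :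
    FreeSpace o →L[ℂ] FreeSpace o :=
  LinearMap.mkContinuous
    { toFun := fun γ => ⟨compOpDual o f hf h0 γ.1, compOpDual_mem o f hf h0 γ⟩
      map_add' := fun γ₁ γ₂ => Subtype.ext (map_add (compOpDual o f hf h0) γ₁.1 γ₂.1)
      map_smul' := fun c γ => Subtype.ext (map_smul (compOpDual o f hf h0) c γ.1) }
    ‖compOpDual o f hf h0‖ fun γ => (compOpDual o f hf h0).le_opNorm γ.1

theorem incl_lipOp (o : M) (f : M → M) {K : ℝ≥0} (hf : LipschitzWith K f) (h0 : f o = o)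
    (γ : FreeSpace o) (g : LipZero o) :
    FreeSpace.incl o (lipOp o f hf h0 γ) g = FreeSpace.incl o γ (compOp o f hf h0 g) := rfl

@[simp] theorem lipOp_delta (o : M) (f : M → M) {K : ℝ≥0} (hf : LipschitzWith K f)
    (h0 : f o = o) (x : M) : lipOp o f hf h0 (delta o x) = delta o (f x) := rfl

theorem eq_lipOp (o : M) (f : M → M) {K : ℝ≥0} (hf : LipschitzWith K f) (h0 : f o = o)
    (T : FreeSpace o →L[ℂ] FreeSpace o) (hT : ∀ x, T (delta o x) = delta o (f x)) :
    T = lipOp o f hf h0 := by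
  have key : ∀ φ (hφ : φ ∈ Submodule.span ℂ (Set.range (evalFunctional o))),
      T ⟨φ, Submodule.le_topologicalClosure _ hφ⟩ =
        lipOp o f hf h0 ⟨φ, Submodule.le_topologicalClosure _ hφ⟩ := by
    intro φ hφ
    induction hφ using Submodule.span_induction with
    | mem φ h =>
      obtain ⟨x, rfl⟩ := h
      exact hT x
    | zero => exact (map_zero T).trans (map_zero (lipOp o f hf h0)).symm
    | add a b ha hb iha ihb =>
      let a' : FreeSpace o := ⟨a, Submodule.le_topologicalClosure _ ha⟩
      let b' : FreeSpace o := ⟨b, Submodule.le_topologicalClosure _ hb⟩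
      exact (map_add T a' b').trans
        ((congrArg₂ (· + ·) iha ihb).trans (map_add (lipOp o f hf h0) a' b').symm)
    | smul c a ha iha =>
      let a' : FreeSpace o := ⟨a, Submodule.le_topologicalClosure _ ha⟩
      exact (map_smul T c a').trans
        ((congrArg (c • ·) iha).trans (map_smul (lipOp o f hf h0) c a').symm)
  ext1 γ
  obtain ⟨u, hu, hlim⟩ := mem_closure_iff_seq_limit.1 γ.2
  have hlim' : Filter.Tendsto
      (fun n => (⟨u n, Submodule.le_topologicalClosure _ (hu n)⟩ : FreeSpace o))
      Filter.atTop (nhds γ) := tendsto_subtype_rng.2 hlim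
  refine tendsto_nhds_unique ((T.continuous.tendsto γ).comp hlim') ?_
  refine (((lipOp o f hf h0).continuous.tendsto γ).comp hlim').congr fun n => ?_
  exact (key (u n) (hu n)).symm

end LipFree

end

/-! Compactness of `f̂` has two effects on `f`. Applied to the unit vectors `(δ x - δ y) / d(x, y)`
with `d(x, y) → 0`, it makes `f` contract by any prescribed ε at small scales
(`exists_locally_flat`); applied to the bounded set `δ(M)`, it makes `f(M)` totally bounded
(`totallyBounded_range`). Points closer than that scale have orbits approaching like `ε ^ n`.
Connectedness extends this decay to every pair, and total boundedness makes it uniform, so the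
Lipschitz constant of `f^[n + 1]` is `O(ε ^ n)` for every ε (`exists_dist_iterate_le`). It bounds
the norms of the powers of both operators; both are quasinilpotent, and their spectra, being
nonempty, equal `{0}`. -/

namespace LipFree

variable {M : Type*} [MetricSpace M]

/-! ### Test functions and completeness of `Lip₀(M)`. -/

namespace LipZero

variable {o : M}

theorem sub_apply (g h : LipZero o) (x : M) : (g - h) x = g x - h x := rfl

/-- Truncation keeps the oscillation at most `r` when `r ≥ 0`, while a point at distance `r` from
`p` still sees all of it. The constant normalizing at `o` cancels in differences. -/
theorem exists_truncated_dist (o p : M) (r : ℝ) :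
    ∃ g : LipZero o, ‖g‖ ≤ 1 ∧
      ∀ x y, g x - g y = ((min (dist x p) r - min (dist y p) r : ℝ) : ℂ) := by
  have key : ∀ x y, ‖((min (dist x p) r - min (dist o p) r : ℝ) : ℂ) -
      ((min (dist y p) r - min (dist o p) r : ℝ) : ℂ)‖ ≤ 1 * dist x y := by
    intro x y
    rw [← Complex.ofReal_sub, Complex.norm_real, Real.norm_eq_abs, sub_sub_sub_cancel_right,
      one_mul]
    refine (abs_min_sub_min_le_max _ _ _ _).trans ?_
    simp only [sub_self, abs_zero]
    exact max_le (abs_dist_sub_le x y p) dist_nonneg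
  refine ⟨⟨fun x => ((min (dist x p) r - min (dist o p) r : ℝ) : ℂ), ⟨1, ?_⟩, by simp⟩,
    norm_le zero_le_one key, ?_⟩
  · exact LipschitzWith.of_dist_le_mul fun x y => by rw [dist_eq_norm]; exact key x y
  · intro x y
    rw [← sub_sub_sub_cancel_right (min (dist x p) r) _ (min (dist o p) r), Complex.ofReal_sub]

/-- Makes the bounded operators a Banach algebra, as nonemptiness of the spectrum requires. The
Cauchy estimate on each pair of points survives the pointwise limit. -/
instance : CompleteSpace (LipZero o) := by
  refine Metric.complete_of_cauchySeq_tendsto fun u hu => ?_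
  have hpt : ∀ x, ∃ l, Filter.Tendsto (fun n => u n x) Filter.atTop (nhds l) := fun x =>
    cauchySeq_tendsto_of_complete (hu.map (evalFunctional o x).uniformContinuous)
  choose g hg using hpt
  have hclose : ∀ ε > 0, ∃ N, ∀ n ≥ N, ∀ x y,
      ‖(u n x - g x) - (u n y - g y)‖ ≤ ε * dist x y := by
    intro ε hε
    obtain ⟨N, hN⟩ := Metric.cauchySeq_iff.1 hu ε hε
    refine ⟨N, fun n hn x y => ?_⟩
    refine le_of_tendsto (((tendsto_const_nhds.sub (hg x)).sub
      (tendsto_const_nhds.sub (hg y))).norm) ?_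
    filter_upwards [Filter.eventually_ge_atTop N] with m hm
    refine (norm_sub_le (u n - u m) x y).trans ?_
    gcongr
    rw [← dist_eq_norm]
    exact (hN n hn m hm).le
  obtain ⟨N, hN⟩ := hclose 1 one_pos
  have hlip : ∀ x y, dist (g x) (g y) ≤ (1 + ‖u N‖) * dist x y := by
    intro x y
    have h1 := hN N le_rfl x y
    have h2 := norm_sub_le (u N) x y
    have h3 : g x - g y = (u N x - u N y) - ((u N x - g x) - (u N y - g y)) := by ring
    rw [dist_eq_norm, h3]
    refine (_root_.norm_sub_le _ _).trans ?_
    linarith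
  have hgo : g o = 0 := by
    refine tendsto_nhds_unique (hg o) ?_
    simp only [apply_base]
    exact tendsto_const_nhds
  have hK : ∃ K : ℝ≥0, LipschitzWith K g :=
    ⟨1 + ‖u N‖₊, LipschitzWith.of_dist_le_mul hlip⟩
  let l : LipZero o := ⟨g, hK, hgo⟩
  refine ⟨l, ?_⟩
  refine Metric.tendsto_atTop.2 fun ε hε => ?_
  obtain ⟨N, hN⟩ := hclose (ε / 2) (half_pos hε)
  refine ⟨N, fun n hn => ?_⟩
  rw [dist_eq_norm]
  exact (norm_le (half_pos hε).le fun x y => hN n hn x y).trans_lt (half_lt_self hε)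

end LipZero

instance (o : M) : CompleteSpace (FreeSpace o) :=
  (Submodule.isClosed_topologicalClosure _).completeSpace_coe

theorem incl_sub_delta_apply {o : M} (x y : M) (g : LipZero o) :
    FreeSpace.incl o (delta o x - delta o y) g = g x - g y := by
  rw [map_sub]; rfl

theorem norm_incl_apply_le {o : M} (γ : FreeSpace o) {g : LipZero o} (hg : ‖g‖ ≤ 1) :
    ‖FreeSpace.incl o γ g‖ ≤ ‖γ‖ := by
  refine ((FreeSpace.incl o γ).le_opNorm g).trans ?_
  rw [LinearIsometry.norm_map]
  exact mul_le_of_le_one_right (norm_nonneg _) hg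

theorem norm_delta_sub (o x y : M) : ‖delta o x - delta o y‖ = dist x y := by
  refine le_antisymm ?_ ?_
  · rw [← (FreeSpace.incl o).norm_map]
    refine ContinuousLinearMap.opNorm_le_bound _ dist_nonneg fun g => ?_
    rw [incl_sub_delta_apply, mul_comm]
    exact g.norm_sub_le x y
  · obtain ⟨g, hg, h⟩ := LipZero.exists_truncated_dist o y (dist x y)
    have := norm_incl_apply_le (delta o x - delta o y) hg
    rw [incl_sub_delta_apply, h] at this
    simpa using this

theorem isometry_delta (o : M) : Isometry (delta o) :=
  Isometry.of_dist_eq fun x y => by rw [dist_eq_norm, norm_delta_sub]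

instance [Nontrivial M] (o : M) : Nontrivial (FreeSpace o) := (isometry_delta o).injective.nontrivial

instance [Nontrivial M] (o : M) : Nontrivial (LipZero o) := by
  obtain ⟨x, hx⟩ := exists_ne o
  obtain ⟨g, -, h⟩ := LipZero.exists_truncated_dist o o (dist x o)
  refine ⟨⟨g, 0, fun h0 => ?_⟩⟩
  have := h x o
  rw [h0] at this
  simp only [LipZero.zero_apply, sub_self, min_self, dist_self, min_eq_left dist_nonneg, sub_zero] at this
  exact hx (dist_eq_zero.1 (Complex.ofReal_eq_zero.1 this.symm))

/-! ### Norms of powers, and the effect of compactness on `f`. -/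

section

variable {o : M} {f : M → M} {K : ℝ≥0} (hf : LipschitzWith K f) (h0 : f o = o)

theorem compOp_pow_apply (n : ℕ) (g : LipZero o) (x : M) :
    (compOp o f hf h0 ^ n) g x = g (f^[n] x) := by
  induction n generalizing g with
  | zero => rfl
  | succ n ih =>
    rw [pow_succ, mul_apply_eq_comp, ih, compOp_apply, Function.iterate_succ_apply']

theorem incl_lipOp_pow (n : ℕ) (γ : FreeSpace o) (g : LipZero o) :
    FreeSpace.incl o ((lipOp o f hf h0 ^ n) γ) g =
      FreeSpace.incl o γ ((compOp o f hf h0 ^ n) g) := by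
  induction n generalizing g with
  | zero => rfl
  | succ n ih =>
    rw [pow_succ', mul_apply_eq_comp, incl_lipOp, ih, pow_succ,
      mul_apply_eq_comp]

theorem norm_lipOp_pow_le (n : ℕ) : ‖lipOp o f hf h0 ^ n‖ ≤ ‖compOp o f hf h0 ^ n‖ := by
  refine ContinuousLinearMap.opNorm_le_bound _ (norm_nonneg _) fun γ => ?_
  rw [← (FreeSpace.incl o).norm_map]
  refine ContinuousLinearMap.opNorm_le_bound _ (by positivity) fun g => ?_
  rw [incl_lipOp_pow]
  refine ((FreeSpace.incl o γ).le_opNorm _).trans ?_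
  rw [LinearIsometry.norm_map, mul_comm ‖compOp o f hf h0 ^ n‖, mul_assoc]
  gcongr
  exact ContinuousLinearMap.le_opNorm _ _

theorem norm_compOp_pow_le {n : ℕ} {C : ℝ} (hC : 0 ≤ C)
    (h : ∀ x y, dist (f^[n] x) (f^[n] y) ≤ C * dist x y) : ‖compOp o f hf h0 ^ n‖ ≤ C := by
  refine ContinuousLinearMap.opNorm_le_bound _ hC fun g => ?_
  refine LipZero.norm_le (by positivity) fun x y => ?_
  rw [compOp_pow_apply, compOp_pow_apply]
  refine (g.norm_sub_le _ _).trans ?_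
  rw [mul_comm C, mul_assoc]
  gcongr
  exact h x y

/-- A compact Lipschitz operator on `F(M)` comes from a uniformly locally flat map. -/
theorem exists_locally_flat (hc : IsCompactOperator (lipOp o f hf h0)) {ε : ℝ} (hε : 0 < ε) :
    ∃ δ > 0, ∀ x y, dist x y < δ → dist (f x) (f y) ≤ ε * dist x y := by
  by_contra! hcon
  choose x y hxy hlt using fun n : ℕ => hcon (1 / (n + 1)) Nat.one_div_pos_of_nat
  set s : ℕ → ℝ := fun n => dist (x n) (y n) with hs
  have hs0 : Filter.Tendsto s Filter.atTop (nhds 0) :=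
    squeeze_zero (fun _ => dist_nonneg) (fun n => (hxy n).le) tendsto_one_div_add_atTop_nhds_zero_nat
  have hspos : ∀ n, 0 < s n := fun n => dist_pos.2 fun h => by
    have := hlt n
    simp [h] at this
  let mol : ℕ → FreeSpace o := fun n => ((s n)⁻¹ : ℂ) • (delta o (x n) - delta o (y n))
  have hmol : ∀ n, mol n ∈ Metric.closedBall (0 : FreeSpace o) 1 := fun n => by
    have := (hspos n).ne'
    simp only [mol, mem_closedBall_zero_iff, norm_smul, norm_delta_sub, norm_inv,
      Complex.norm_real, Real.norm_eq_abs, abs_of_pos (hspos n)]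
    exact (inv_mul_cancel₀ this).le
  obtain ⟨Q, hQ, hsub⟩ := 
    hc.image_closedBall_subset_compact (f := (lipOp o f hf h0).toLinearMap) 1
  obtain ⟨γ, -, φ, hφ, hlim⟩ := hQ.tendsto_subseq fun n => hsub ⟨mol n, hmol n, rfl⟩
  obtain ⟨N, hN⟩ := Metric.cauchySeq_iff.1 hlim.cauchySeq (ε / 2) (half_pos hε)
  -- The scale `s i` is chosen so small against `s j` that even `f (x i)` and `f (y i)` are within
  -- `ε / 2 * s j`; `K + 1` avoids dividing by zero.
  have hpos : 0 < ε / 2 * s (φ N) / (K + 1) := by have := hspos (φ N); positivity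
  obtain ⟨m, hm, hmN⟩ := (((hs0.comp hφ.tendsto_atTop).eventually (gt_mem_nhds hpos)).and
    (Filter.eventually_ge_atTop N)).exists
  set i := φ m
  set j := φ N
  have hdist : dist (lipOp o f hf h0 (mol i)) (lipOp o f hf h0 (mol j)) < ε / 2 :=
    hN m hmN N le_rfl
  have himg : ∀ n (g : LipZero o), FreeSpace.incl o (lipOp o f hf h0 (mol n)) g =
      ((s n)⁻¹ : ℂ) * (g (f (x n)) - g (f (y n))) := fun n g => by
    rw [incl_lipOp]
    simp only [mol, map_smul, smul_apply, incl_sub_delta_apply, compOp_apply,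
      smul_eq_mul]
  -- Truncated at `d(f (x i), f (y i))`, this `g` takes a value of modulus at least ε on the image
  -- of `mol i` but at most `ε / 2` on that of `mol j`, so the images cannot be closer than `ε / 2`.
  obtain ⟨g, hg, hgd⟩ := LipZero.exists_truncated_dist o (f (y i)) (dist (f (x i)) (f (y i)))
  have hle := norm_incl_apply_le (lipOp o f hf h0 (mol i) - lipOp o f hf h0 (mol j)) hg
  rw [← dist_eq_norm] at hle
  have hbig : ε ≤ ‖FreeSpace.incl o (lipOp o f hf h0 (mol i)) g‖ := by
    rw [himg, hgd, norm_mul, norm_inv, Complex.norm_real, Complex.norm_real, Real.norm_eq_abs,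
      Real.norm_eq_abs, abs_of_pos (hspos i), min_self, dist_self, min_eq_left dist_nonneg,
      sub_zero, abs_of_nonneg dist_nonneg, inv_mul_eq_div, le_div_iff₀ (hspos i)]
    exact (hlt i).le
  have hsmall : ‖FreeSpace.incl o (lipOp o f hf h0 (mol j)) g‖ ≤ ε / 2 := by
    rw [himg, hgd, norm_mul, norm_inv, Complex.norm_real, Complex.norm_real, Real.norm_eq_abs,
      Real.norm_eq_abs, abs_of_pos (hspos j), inv_mul_eq_div, div_le_iff₀ (hspos j)]
    have hi : dist (f (x i)) (f (y i)) ≤ ε / 2 * s j := by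
      have h1 := hf.dist_le_mul (x i) (y i)
      have h2 : s i * (K + 1) < ε / 2 * s j := (lt_div_iff₀ (by positivity)).1 hm
      have h3 : dist (x i) (y i) = s i := rfl
      nlinarith [hspos i]
    refine le_trans ?_ hi
    have a1 : 0 ≤ dist (f (x i)) (f (y i)) := dist_nonneg
    have := fun z => le_min (dist_nonneg : 0 ≤ dist z (f (y i))) a1
    have h2 := fun z => min_le_right (dist z (f (y i))) (dist (f (x i)) (f (y i)))
    rw [abs_le]
    constructor <;> linarith [this (f (x j)), this (f (y j)), h2 (f (x j)), h2 (f (y j))]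
  rw [map_sub, sub_apply] at hle
  have := norm_sub_norm_le (FreeSpace.incl o (lipOp o f hf h0 (mol i)) g)
    (FreeSpace.incl o (lipOp o f hf h0 (mol j)) g)
  linarith

theorem totallyBounded_range [BoundedSpace M] (hc : IsCompactOperator (lipOp o f hf h0)) :
    TotallyBounded (Set.range f) := by
  have hb : Bornology.IsBounded (Set.range (delta o)) := by
    rw [← Set.image_univ]
    exact (isometry_delta o).lipschitz.isBounded_image (Bornology.IsBounded.all _)
  obtain ⟨Q, hQ, hsub⟩ := hc.image_subset_compact_of_bounded (f := (lipOp o f hf h0).toLinearMap) hb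
  refine (totallyBounded_preimage (isometry_delta o).isUniformInducing
    hQ.totallyBounded).subset ?_
  rintro _ ⟨x, rfl⟩
  exact hsub ⟨_, ⟨x, rfl⟩, rfl⟩

end

/-! ### Decay of the Lipschitz constants of iterates. -/

theorem dist_iterate_le_of_locally_flat {f : M → M} {ε δ : ℝ} (hε : 0 ≤ ε) (hε1 : ε ≤ 1)
    (h : ∀ x y, dist x y < δ → dist (f x) (f y) ≤ ε * dist x y) (n : ℕ) {x y : M}
    (hxy : dist x y < δ) : dist (f^[n] x) (f^[n] y) ≤ ε ^ n * dist x y := by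
  induction n with
  | zero => simp
  | succ n ih =>
    rw [Function.iterate_succ_apply', Function.iterate_succ_apply', pow_succ', mul_assoc]
    refine (h _ _ ?_).trans (by gcongr)
    exact (ih.trans (mul_le_of_le_one_left dist_nonneg (pow_le_one₀ hε hε1))).trans_lt hxy

/-- On a connected space, a uniformly locally flat map with totally bounded range has iterates
whose Lipschitz constants decay faster than any geometric sequence. -/
theorem exists_dist_iterate_le [PreconnectedSpace M] {f : M → M}
    (htb : TotallyBounded (Set.range f))
    (hflat : ∀ ε > 0, ∃ δ > 0, ∀ x y, dist x y < δ → dist (f x) (f y) ≤ ε * dist x y)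
    {ε : ℝ} (hε : 0 < ε) (hε1 : ε ≤ 1) :
    ∃ C ≥ 0, ∀ n x y, dist (f^[n + 1] x) (f^[n + 1] y) ≤ C * ε ^ n * dist x y := by
  obtain ⟨δ, hδ, hfl⟩ := hflat ε hε
  have hstep := fun n x y => dist_iterate_le_of_locally_flat hε.le hε1 hfl n (x := x) (y := y)
  -- Geometric decay along orbits is a symmetric transitive relation that holds between nearby
  -- points, hence between all points of a connected space.
  have hpair : ∀ x y : M, ∃ C, 0 ≤ C ∧ ∀ n, dist (f^[n] x) (f^[n] y) ≤ C * ε ^ n := by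
    have : IsPreconnected (Set.univ : Set M) := isPreconnected_univ
    refine fun x y => this.induction₂
      (fun x y => ∃ C, 0 ≤ C ∧ ∀ n, dist (f^[n] x) (f^[n] y) ≤ C * ε ^ n) ?_ ?_ ?_ trivial trivial
    · intro x _
      rw [nhdsWithin_univ]
      filter_upwards [Metric.ball_mem_nhds x hδ] with y hy
      exact ⟨dist x y, dist_nonneg, fun n => by
        rw [mul_comm]; exact hstep n x y (by rwa [dist_comm])⟩
    · rintro x y z - - - ⟨C, hC0, hC⟩ ⟨D, hD0, hD⟩
      refine ⟨C + D, add_nonneg hC0 hD0, fun n => (dist_triangle _ (f^[n] y) _).trans ?_⟩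
      rw [add_mul]
      exact add_le_add (hC n) (hD n)
    · rintro x y - - ⟨C, hC0, hC⟩
      exact ⟨C, hC0, fun n => by rw [dist_comm]; exact hC n⟩
  choose C hC0 hC using hpair
  obtain ⟨t, ht, hcov⟩ := Metric.totallyBounded_iff.1 htb δ hδ
  obtain ⟨B, hB⟩ := ((ht.prod ht).image fun p => C p.1 p.2).bddAbove
  -- Two moves to the finite net, each shorter than δ, plus the worst constant between net points.
  -- The net covers only the range of `f`, which costs one iterate: hence `n + 1`.
  set L := 2 * δ + max B 0 with hL
  have hL0 : 0 ≤ L := by positivity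
  have hrange : ∀ n x y, dist (f^[n + 1] x) (f^[n + 1] y) ≤ L * ε ^ n := by
    intro n x y
    obtain ⟨a, ha, hxa⟩ := Set.mem_iUnion₂.1 (hcov ⟨x, rfl⟩)
    obtain ⟨b, hb, hyb⟩ := Set.mem_iUnion₂.1 (hcov ⟨y, rfl⟩)
    rw [Metric.mem_ball] at hxa hyb
    have hab : C a b ≤ max B 0 := (hB ⟨(a, b), ⟨ha, hb⟩, rfl⟩).trans (le_max_left _ _)
    rw [Function.iterate_succ_apply, Function.iterate_succ_apply]
    have h1 := hstep n _ _ hxa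
    have h2 := hstep n _ _ hyb
    rw [dist_comm] at h2
    have h3 := hC a b n
    have h4 := dist_triangle4 (f^[n] (f x)) (f^[n] a) (f^[n] b) (f^[n] (f y))
    have hp : 0 < ε ^ n := by positivity
    rw [hL]
    nlinarith
  -- The entry `1` serves pairs closer than δ; for the others `dist x y ≥ δ` converts `L` into `L /
  -- δ * dist x y`.
  refine ⟨max 1 (L / δ), by positivity, fun n x y => ?_⟩
  rcases lt_or_ge (dist x y) δ with hxy | hxy
  · refine (hstep (n + 1) x y hxy).trans ?_
    gcongr
    rw [pow_succ, mul_comm]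
    gcongr
    exact hε1.trans (le_max_left _ _)
  · refine (hrange n x y).trans ?_
    calc L * ε ^ n = L / δ * ε ^ n * δ := by field_simp
      _ ≤ max 1 (L / δ) * ε ^ n * dist x y := by
        gcongr
        exact le_max_right _ _

theorem spectrum_eq_zero_of_norm_pow_le {A : Type*} [NormedRing A] [NormedAlgebra ℂ A]
    [CompleteSpace A] [Nontrivial A] (a : A)
    (h : ∀ ε > 0, ε ≤ 1 → ∃ C ≥ 0, ∀ n, ‖a ^ (n + 1)‖ ≤ C * ε ^ n) : spectrum ℂ a = {0} := by
  refine (spectrum.nonempty a).subset_singleton_iff.1 fun z hz => ?_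
  by_contra hz0
  have hzpos : 0 < ‖z‖ := norm_pos_iff.2 hz0
  -- A rate at most half of `‖z‖` makes `‖z‖ ^ (n + 1) ≤ ‖a ^ (n + 1)‖ * ‖1‖` fail for large `n`.
  obtain ⟨C, hC0, hC⟩ := h (min (‖z‖ / 2) 1) (by positivity) (min_le_right _ _)
  have hb : ∀ n : ℕ, ‖z‖ ≤ C * ‖(1 : A)‖ * (1 / 2) ^ n := by
    intro n
    have h1 := spectrum.norm_le_norm_mul_of_mem (spectrum.pow_mem_pow a (n + 1) hz)
    have h2 : C * min (‖z‖ / 2) 1 ^ n ≤ C * (‖z‖ / 2) ^ n := by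
      gcongr
      exact min_le_left _ _
    have h3 : ‖z‖ ^ (n + 1) ≤ C * (‖z‖ / 2) ^ n * ‖(1 : A)‖ := by
      rw [← norm_pow]
      exact h1.trans (mul_le_mul_of_nonneg_right ((hC n).trans h2) (norm_nonneg _))
    refine le_of_mul_le_mul_left ?_ (pow_pos hzpos n)
    calc ‖z‖ ^ n * ‖z‖ = ‖z‖ ^ (n + 1) := (pow_succ _ _).symm
      _ ≤ _ := h3
      _ = _ := by rw [div_eq_mul_one_div, mul_pow]; ring
  have hlim := (tendsto_pow_atTop_nhds_zero_of_lt_one (by norm_num : (0 : ℝ) ≤ 1 / 2)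
    (by norm_num)).const_mul (C * ‖(1 : A)‖)
  rw [mul_zero] at hlim
  exact hzpos.not_ge (ge_of_tendsto' hlim hb)

end LipFree

theorem mainTheorem4 {M : Type*} [MetricSpace M] [ConnectedSpace M] [BoundedSpace M]
    [Nontrivial M] (o : M) (f : M → M) {K : NNReal} (hf : LipschitzWith K f) (h0 : f o = o)
    (hcompact : IsCompactOperator (LipFree.lipOp o f hf h0)) :
    spectrum ℂ (LipFree.compOp o f hf h0) = spectrum ℂ (LipFree.lipOp o f hf h0) ∧
      spectrum ℂ (LipFree.lipOp o f hf h0) = {0} := by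
  have hpow : ∀ ε : ℝ, ε > 0 → ε ≤ 1 →
      ∃ C ≥ 0, ∀ n, ‖LipFree.compOp o f hf h0 ^ (n + 1)‖ ≤ C * ε ^ n := fun ε hε hε1 => by
    obtain ⟨C, hC0, hC⟩ := LipFree.exists_dist_iterate_le
      (LipFree.totallyBounded_range hf h0 hcompact)
      (fun ε hε => LipFree.exists_locally_flat hf h0 hcompact hε) hε hε1
    exact ⟨C, hC0, fun n => LipFree.norm_compOp_pow_le hf h0 (by positivity) (hC n)⟩
  have h1 := LipFree.spectrum_eq_zero_of_norm_pow_le (LipFree.compOp o f hf h0) hpow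
  have h2 := LipFree.spectrum_eq_zero_of_norm_pow_le (LipFree.lipOp o f hf h0)
    fun ε hε hε1 => by
      obtain ⟨C, hC0, hC⟩ := hpow ε hε hε1
      exact ⟨C, hC0, fun n => (LipFree.norm_lipOp_pow_le hf h0 (n + 1)).trans (hC n)⟩
  exact ⟨h1.trans h2.symm, h2⟩
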